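/- Let $n\ge 0$ and let $M:=\mathbb{C}^n/2\pi i\,\mathbb{Z}^n$, with coordinates $z_j=x_j+iy_j$; the exponential map identifies $M$ with $(\mathbb{C}^*)^n$. For $x\in\mathbb{R}^n$ let $L_x\subset M$ be the canonical $n$-torus obtained by fixing the real parts of the coordinates to be $x_1,\dots,x_n$, oriented by $(y_1,\dots,y_n)$; in $(\mathbb{C}^*)^n$ it is the torus $|w_j|=r_j$ with $x_j=\log r_j$. It is totally real. Let $h$ be a smooth Hermitian metric on the anti-canonical line bundle $K_M^{-1}=\Lambda^n_{\mathbb{C}}TM$ (for example, one induced by a Hermitian metric on $M$). Let $\sigma:=\partial_{y_1}\wedge\dots\wedge\partial_{y_n}$, $H:=h(\sigma,\sigma)$, and let $\rho:=i\Theta=i\partial\bar\partial(-\log H)$, where $\Theta=\bar\partial\partial\log H$ is the curvature of the Chern connection of $h$. We write $\rho\le 0$ (resp. $\rho\ge 0$) if $\rho(v,Jv)\le 0$ (resp. $\ge 0$) for every tangent vector $v$ of $M$. For an oriented totally real $n$-dimensional submanifold $L\subset M$ define the $J$-volume $\mathrm{Vol}_J(L):=\int_L\mathrm{vol}_J$,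 where $\mathrm{vol}_J$ is the restriction to $TL$ of the $(n,0)$-form $\Omega_J:=|v_1\wedge\dots\wedge v_n|_h\cdot v_1^*\wedge\dots\wedge v_n^*$; here $v_1,\dots,v_n$ is any positive real basis of $T_pL$, which is also a complex basis of $T_pM$, and $v_1^*,\dots,v_n^*$ is the complex dual basis. Then: 1. If $\rho\le 0$, then $x\mapsto \mathrm{Vol}_J(L_x)$ is a convex function on $\mathbb{R}^n$. 2. If $h$ is invariant under the action of $\mathbb{T}^n=\mathbb{R}^n/2\pi\mathbb{Z}^n$ on $M$ given by $t\cdot[z]=[z+it]$, then $\rho\le 0$ if and only if $x\mapsto\log\mathrm{Vol}_J(L_x)$ is convex on $\mathbb{R}^n$, and $\rho\ge 0$ if and only if $x\mapsto\log\mathrm{Vol}_J(L_x)$ is concave on $\mathbb{R}^n$. -/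

import Mathlib

open scoped ContDiff

noncomputable section

namespace TorusVolume

/-- Complex coordinate space `ℂⁿ`. -/
abbrev Cn (n : ℕ) : Type := Fin n → ℂ

/-- The lattice `2πi ℤⁿ` in `ℂⁿ`. -/
def periodLattice (n : ℕ) : AddSubgroup (Cn n) where
  carrier := {w | ∃ k : Fin n → ℤ, ∀ j, w j = 2 * Real.pi * Complex.I * k j}
  zero_mem' := ⟨0, fun j => by simp⟩
  add_mem' := by
    rintro a b ⟨k, hk⟩ ⟨l, hl⟩
    exact ⟨k + l, fun j => by simp [hk, hl]; ring⟩
  neg_mem' := by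
    rintro a ⟨k, hk⟩
    exact ⟨-k, fun j => by simp [hk]⟩

/-- The complex manifold `M = ℂⁿ / 2πi ℤⁿ`, which the exponential map identifies with `(ℂ*)ⁿ`. -/
abbrev Cyl (n : ℕ) : Type := Cn n ⧸ periodLattice n

/-- The quotient map `ℂⁿ → M`. It is a holomorphic covering; its local inverses are the
holomorphic charts `z = x + i y` of `M`, and all their transition maps are translations. Through its
differential every tangent space of `M` (a complex vector space, `J` being multiplication by `i`)
is `ℂⁿ`, independently of the chart. -/
def proj {n : ℕ} (z : Cn n) : Cyl n := QuotientAddGroup.mk z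

/-- The fibre of the anti-canonical bundle `K_M⁻¹`: the top exterior power over `ℂ` of the tangent
space. -/
abbrev AntiCan (n : ℕ) : Type := ⋀[ℂ]^n (Cn n)

/-- The decomposable element `v₁ ∧ … ∧ vₙ` of the anti-canonical fibre. -/
def wedge {n : ℕ} (v : Fin n → Cn n) : AntiCan n := exteriorPower.ιMulti ℂ n v

/-- A (smooth) Hermitian metric on the holomorphic line bundle `K_M⁻¹`: a positive definite
Hermitian form on every fibre, depending smoothly on the base point. Sections constant in the
coordinates `z` are multiples of the holomorphic frame `∂z₁ ∧ … ∧ ∂zₙ`, so smoothness may be tested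
on them. -/
structure HermitianMetric (n : ℕ) where
  /-- The Hermitian form on the fibre over `p`, conjugate-linear in the first argument. -/
  form : Cyl n → AntiCan n →ₗ⋆[ℂ] AntiCan n →ₗ[ℂ] ℂ
  conj_symm : ∀ p s t, (starRingEnd ℂ) (form p s t) = form p t s
  pos : ∀ p s, s ≠ 0 → 0 < (form p s s).re
  smooth : ∀ s t, ContDiff ℝ ∞ (fun z : Cn n => form (proj z) s t)

/-- Multiplication by `i` on `ℂⁿ`, as a real linear map. -/
def J (n : ℕ) : Cn n →L[ℝ] Cn n := Complex.I • ContinuousLinearMap.id ℝ (Cn n)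

/-- The vector field `∂/∂yⱼ`, in the coordinates `z = x + i y`. -/
def partialY {n : ℕ} (j : Fin n) : Cn n := Complex.I • Pi.single j (1 : ℂ)

/-- For a real function `f` on `ℂⁿ`, the `(1,0)`-form
`∂f(v) = (df(v) - i df(Jv)) / 2`. -/
def del {n : ℕ} (f : Cn n → ℝ) (z : Cn n) : Cn n →L[ℝ] ℂ :=
  (1 / 2 : ℂ) • (Complex.ofRealCLM.comp (fderiv ℝ f z)
    - Complex.I • Complex.ofRealCLM.comp ((fderiv ℝ f z).comp (J n)))

/-- The exterior derivative of a complex-valued `1`-form on `ℂⁿ`. -/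
def extD {n : ℕ} (α : Cn n → Cn n →L[ℝ] ℂ) (z u v : Cn n) : ℂ :=
  fderiv ℝ α z u v - fderiv ℝ α z v u

/-- The norm `|s|_h` of an element of the fibre over `p`. -/
def HermitianMetric.norm {n : ℕ} (h : HermitianMetric n) (p : Cyl n) (s : AntiCan n) : ℝ :=
  Real.sqrt (h.form p s s).re

/-- The function `H = h(σ, σ)`, where `σ = ∂y₁ ∧ … ∧ ∂yₙ` is the global nowhere-vanishing holomorphic
section of `K_M⁻¹`; written in the coordinates `z`. -/
def HermitianMetric.H {n : ℕ} (h : HermitianMetric n) (z : Cn n) : ℝ :=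
  (h.form (proj z) (wedge partialY) (wedge partialY)).re

/-- The connection `1`-form `∂ log H` of the Chern connection in the frame `σ`. -/
def HermitianMetric.chernForm {n : ℕ} (h : HermitianMetric n) : Cn n → Cn n →L[ℝ] ℂ :=
  del (fun z => Real.log (h.H z))

/-- The curvature `Θ = d(∂ log H) = ∂̄∂ log H` of the Chern connection, at the point of `M` with
coordinates `z`. -/
def HermitianMetric.chernCurvature {n : ℕ} (h : HermitianMetric n) (z u v : Cn n) : ℂ :=
  extD h.chernForm z u v

/-- The real `(1,1)`-form `ρ = iΘ = i∂∂̄(-log H)`, at the point of `M` with coordinates `z`. That `iΘ` is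
real-valued is shown in `ofReal_rho`. -/
def HermitianMetric.rho {n : ℕ} (h : HermitianMetric n) (z u v : Cn n) : ℝ :=
  (Complex.I * h.chernCurvature z u v).re

/-- `ρ ≤ 0`: the symmetric form `ρ(·, J·)` is negative semi-definite at every point. -/
def HermitianMetric.CurvatureNonpos {n : ℕ} (h : HermitianMetric n) : Prop :=
  ∀ z v : Cn n, h.rho z v (J n v) ≤ 0

/-- `ρ ≥ 0`: the symmetric form `ρ(·, J·)` is positive semi-definite at every point. -/
def HermitianMetric.CurvatureNonneg {n : ℕ} (h : HermitianMetric n) : Prop :=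
  ∀ z v : Cn n, 0 ≤ h.rho z v (J n v)

/-- The action of `t ∈ 𝕋ⁿ = ℝⁿ / 2πℤⁿ` on `M`, namely `[z] ↦ [z + i t]`; on `(ℂ*)ⁿ` this is the
rotation of the `j`-th coordinate by `e^{i tⱼ}`. -/
def rotate {n : ℕ} (t : Fin n → ℝ) (p : Cyl n) : Cyl n :=
  p + proj (fun j => Complex.I * t j)

/-- Invariance of the metric under `𝕋ⁿ`. The action is by translations in the coordinates `z`, so
that its differential is the identity of `ℂⁿ`, and so is the induced map between the fibres of
`K_M⁻¹`. -/
def HermitianMetric.IsTorusInvariant {n : ℕ} (h : HermitianMetric n) : Prop :=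
  ∀ (t : Fin n → ℝ) (p : Cyl n) (s s' : AntiCan n), h.form (rotate t p) s s' = h.form p s s'

/-- A real subspace `T` of `ℂⁿ` is totally real if `T ∩ J T = 0`. -/
def IsTotallyReal {n : ℕ} (T : Submodule ℝ (Cn n)) : Prop :=
  T ⊓ T.map (J n : Cn n →ₗ[ℝ] Cn n) = ⊥

/-- An embedded totally real `n`-torus in `M`, oriented by a parametrization: a smooth map
`y ↦ [lift y]` that is an injective immersion of `ℝⁿ / 2πℤⁿ` into `M` with totally real tangent
spaces. -/
structure TRTorus (n : ℕ) where
  /-- A lift to `ℂⁿ` of the parametrization, on the universal cover `ℝⁿ` of the torus. -/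
  lift : (Fin n → ℝ) → Cn n
  smooth : ContDiff ℝ ∞ lift
  proj_eq_iff : ∀ y y', proj (lift y) = proj (lift y') ↔
    ∃ k : Fin n → ℤ, ∀ j, y' j = y j + 2 * Real.pi * k j
  immersion : ∀ y, Function.Injective (fderiv ℝ lift y)
  totallyReal : ∀ y, IsTotallyReal (LinearMap.range (fderiv ℝ lift y : (Fin n → ℝ) →ₗ[ℝ] Cn n))

/-- The torus as a subset of `M`. -/
def TRTorus.carrier {n : ℕ} (L : TRTorus n) : Set (Cyl n) := Set.range fun y => proj (L.lift y)

/-- The coordinate vectors `vⱼ`, images of the coordinate vector fields of the parametrization: a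
positive real basis of the tangent space of the torus. -/
def TRTorus.tangent {n : ℕ} (L : TRTorus n) (y : Fin n → ℝ) (j : Fin n) : Cn n :=
  fderiv ℝ L.lift y (Pi.single j 1)

/-- A real basis of a totally real tangent space is independent over `ℂ`. -/
theorem TRTorus.linearIndependent {n : ℕ} (L : TRTorus n) (y : Fin n → ℝ) :
    LinearIndependent ℂ (L.tangent y) := by
  rw [Fintype.linearIndependent_iff]
  intro g hg
  have key : ∀ a : Fin n → ℝ, fderiv ℝ L.lift y a = ∑ j, (a j : ℂ) • L.tangent y j := by
    intro a
    conv_lhs => rw [pi_eq_sum_univ' a]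
    rw [map_sum]
    refine Finset.sum_congr rfl fun j _ => ?_
    rw [map_smul, Complex.coe_smul]
    congr 2
  have h1 : fderiv ℝ L.lift y (fun j => (g j).re)
      = J n (fderiv ℝ L.lift y (fun j => -(g j).im)) := by
    rw [key, key]
    simp only [J, _root_.smul_apply, ContinuousLinearMap.id_apply, Finset.smul_sum]
    rw [← sub_eq_zero, ← Finset.sum_sub_distrib, ← hg]
    refine Finset.sum_congr rfl fun j _ => ?_
    rw [smul_smul, ← sub_smul]
    congr 1
    conv_rhs => rw [← Complex.re_add_im (g j)]
    push_cast
    ring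
  have h2 : fderiv ℝ L.lift y (fun j => (g j).re) = 0 := by
    have := L.totallyReal y
    rw [IsTotallyReal, Submodule.eq_bot_iff] at this
    refine this _ ⟨⟨_, rfl⟩, ?_⟩
    rw [h1]
    exact ⟨_, ⟨_, rfl⟩, rfl⟩
  have h3 : fderiv ℝ L.lift y (fun j => -(g j).im) = 0 := by
    rw [h2] at h1
    simpa [J] using h1.symm
  have h4 := L.immersion y (h2.trans (map_zero _).symm)
  have h5 := L.immersion y (h3.trans (map_zero _).symm)
  intro j
  apply Complex.ext
  · exact congrFun h4 j
  · simpa using congrFun h5 j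

/-- The coordinate vectors as a complex basis of the tangent space of `M`. -/
def TRTorus.frame {n : ℕ} (L : TRTorus n) (y : Fin n → ℝ) : Module.Basis (Fin n) ℂ (Cn n) :=
  Module.Basis.mk (L.linearIndependent y)
    ((L.linearIndependent y).span_eq_top_of_card_eq_finrank' (by simp)).ge

/-- The `(n,0)`-form `Ω_J = |v₁ ∧ … ∧ vₙ|_h · (v₁* ∧ … ∧ vₙ*)` at `p`, for a basis `v` of a totally real
tangent space at `p`; here `v₁* ∧ … ∧ vₙ*` is the complex determinant with respect to `v`. -/
def HermitianMetric.omegaJ {n : ℕ} (h : HermitianMetric n) (p : Cyl n)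
    (v : Module.Basis (Fin n) ℂ (Cn n)) : Cn n [⋀^Fin n]→ₗ[ℂ] ℂ :=
  (h.norm p (wedge v) : ℂ) • v.det

/-- The density in the coordinates `y` of the real `n`-form `vol_J`, the restriction of `Ω_J` to the
torus. -/
def HermitianMetric.volJDensity {n : ℕ} (h : HermitianMetric n) (L : TRTorus n)
    (y : Fin n → ℝ) : ℝ :=
  (h.omegaJ (proj (L.lift y)) (L.frame y) (L.tangent y)).re

/-- The `J`-volume `Vol_J(L) = ∫_L vol_J`, over a fundamental cube of `ℝⁿ / 2πℤⁿ`. -/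
def HermitianMetric.VolJ {n : ℕ} (h : HermitianMetric n) (L : TRTorus n) : ℝ :=
  ∫ y in Set.Icc (0 : Fin n → ℝ) (fun _ => 2 * Real.pi), h.volJDensity L y

/-- The derivative of `y ↦ x + i y`. -/
def iMap (n : ℕ) : (Fin n → ℝ) →L[ℝ] Cn n :=
  ContinuousLinearMap.pi fun j =>
    Complex.I • Complex.ofRealCLM.comp (ContinuousLinearMap.proj (R := ℝ) j)

theorem iMap_apply {n : ℕ} (y : Fin n → ℝ) (j : Fin n) : iMap n y j = Complex.I * y j := by
  simp [iMap]

theorem hasFDerivAt_canonical {n : ℕ} (x y : Fin n → ℝ) :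
    HasFDerivAt (fun y : Fin n → ℝ => fun j => (x j : ℂ) + Complex.I * y j) (iMap n) y := by
  have h : (fun y : Fin n → ℝ => fun j => (x j : ℂ) + Complex.I * y j)
      = fun y => (fun j => (x j : ℂ)) + iMap n y := by
    funext y j
    simp [iMap_apply]
  rw [h]
  exact (iMap n).hasFDerivAt.const_add _

/-- The canonical `n`-torus `x = const` in `M`, parametrized by `y ↦ [x + i y]`. In `(ℂ*)ⁿ` it is the torus
`|wⱼ| = rⱼ` whose log-radii are `log rⱼ = xⱼ`. -/
def canonicalTorus {n : ℕ} (x : Fin n → ℝ) : TRTorus n where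
  lift := fun y j => (x j : ℂ) + Complex.I * y j
  smooth := by
    have h : (fun y : Fin n → ℝ => fun j => (x j : ℂ) + Complex.I * y j)
        = fun y => (fun j => (x j : ℂ)) + iMap n y := by
      funext y j
      simp [iMap_apply]
    rw [h]
    exact contDiff_const.add (iMap n).contDiff
  proj_eq_iff := by
    intro y y'
    rw [proj, proj, QuotientAddGroup.eq]
    refine exists_congr fun k => forall_congr' fun j => ?_
    simp only [Pi.add_apply, Pi.neg_apply]
    constructor
    · intro h
      have := congrArg Complex.im h
      simp at this
      linarith
    · intro h
      rw [h]
      push_cast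
      ring
  immersion := by
    intro y a b hab
    rw [(hasFDerivAt_canonical x y).fderiv] at hab
    funext j
    have := congrFun hab j
    simpa [iMap_apply] using this
  totallyReal := by
    intro y
    rw [(hasFDerivAt_canonical x y).fderiv, IsTotallyReal, Submodule.eq_bot_iff]
    rintro w ⟨⟨a, rfl⟩, ⟨_, ⟨b, rfl⟩, hb⟩⟩
    funext j
    have := congrArg Complex.im (congrFun hb j)
    simp [J, iMap_apply] at this
    simp [iMap_apply, ← this]

theorem canonicalTorus_carrier {n : ℕ} (x : Fin n → ℝ) :
    (canonicalTorus x).carrier = proj '' {z : Cn n | ∀ j, (z j).re = x j} := by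
  ext p
  constructor
  · rintro ⟨y, rfl⟩
    exact ⟨_, fun j => by simp [canonicalTorus], rfl⟩
  · rintro ⟨z, hz, rfl⟩
    refine ⟨fun j => (z j).im, ?_⟩
    change proj _ = proj _
    congr 1
    funext j
    apply Complex.ext <;> simp [canonicalTorus, (hz j)]

theorem wedge_partialY_ne_zero {n : ℕ} : wedge (partialY : Fin n → Cn n) ≠ 0 := by
  intro h
  let d := (Pi.basisFun ℂ (Fin n)).det
  have h1 : d partialY = 0 := by
    have := exteriorPower.alternatingMapLinearEquiv_apply_ιMulti d partialY
    rw [← this]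
    change exteriorPower.alternatingMapLinearEquiv d (wedge partialY) = 0
    rw [h, map_zero]
  have h2 : d (fun j => Complex.I • Pi.basisFun ℂ (Fin n) j) = 0 := by
    rw [← h1]
    congr 1
    funext j
    simp [partialY]
  have h3 : d (fun j => Complex.I • Pi.basisFun ℂ (Fin n) j)
      = (∏ _j : Fin n, Complex.I) • d (Pi.basisFun ℂ (Fin n)) :=
    d.map_smul_univ (fun _ => Complex.I) _
  rw [h3, Module.Basis.det_self] at h2
  simp at h2

theorem HermitianMetric.H_pos {n : ℕ} (h : HermitianMetric n) (z : Cn n) : 0 < h.H z :=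
  h.pos _ _ wedge_partialY_ne_zero

theorem HermitianMetric.contDiff_log_H {n : ℕ} (h : HermitianMetric n) :
    ContDiff ℝ ∞ (fun z => Real.log (h.H z)) := by
  refine ContDiff.log ?_ fun z => (h.H_pos z).ne'
  exact Complex.reCLM.contDiff.comp (h.smooth _ _)

theorem fderiv_del_apply {n : ℕ} {f : Cn n → ℝ} (hf : ContDiff ℝ ∞ f) (z u v : Cn n) :
    fderiv ℝ (del f) z u v = (1 / 2 : ℂ) *
      ((fderiv ℝ (fderiv ℝ f) z u v : ℂ) - Complex.I * fderiv ℝ (fderiv ℝ f) z u (J n v)) := by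
  have hg : Differentiable ℝ (fderiv ℝ f) :=
    (hf.fderiv_right (m := 1) (by norm_cast)).differentiable (by norm_num)
  have hd : DifferentiableAt ℝ (del f) z := by
    unfold del
    fun_prop
  have h1 : fderiv ℝ (fun w => del f w v) z u = fderiv ℝ (del f) z u v := by
    rw [fderiv_clm_apply hd (differentiableAt_const v)]
    simp
  have h2 : ∀ w : Cn n, HasFDerivAt (fun z => fderiv ℝ f z w)
      ((fderiv ℝ (fderiv ℝ f) z).flip w) z := by
    intro w
    have := (hg z).hasFDerivAt.clm_apply (hasFDerivAt_const w z)
    simpa using this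
  have h3 : HasFDerivAt (fun w => del f w v)
      ((1 / 2 : ℂ) • (Complex.ofRealCLM.comp ((fderiv ℝ (fderiv ℝ f) z).flip v)
        - Complex.I • Complex.ofRealCLM.comp ((fderiv ℝ (fderiv ℝ f) z).flip (J n v)))) z :=
    ((Complex.ofRealCLM.hasFDerivAt.comp z (h2 v)).sub
      ((Complex.ofRealCLM.hasFDerivAt.comp z (h2 (J n v))).const_smul Complex.I)).const_smul
        (1 / 2 : ℂ)
  rw [← h1, h3.fderiv]
  simp

/-- The form `iΘ` is real-valued. -/
theorem HermitianMetric.ofReal_rho {n : ℕ} (h : HermitianMetric n) (z u v : Cn n) :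
    (h.rho z u v : ℂ) = Complex.I * h.chernCurvature z u v := by
  have hs : fderiv ℝ (fderiv ℝ fun z => Real.log (h.H z)) z u v
      = fderiv ℝ (fderiv ℝ fun z => Real.log (h.H z)) z v u :=
    (h.contDiff_log_H.contDiffAt.isSymmSndFDerivAt (by simp; norm_cast)) u v
  apply Complex.ext
  · simp [rho]
  · simp only [chernCurvature, extD, chernForm, fderiv_del_apply h.contDiff_log_H, hs]
    simp

end TorusVolume

end

open scoped ContDiff

noncomputable section

namespace TorusVolume

open MeasureTheory Set

/-! The coordinate frame of a canonical torus is `σ` itself, so `Vol_J(L_x)` is the integral of `F =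
√H = exp(½ log H)` at `x + iy` over the period cube in `y`. Since `ρ(v, Jv)` is minus half the Levi
form `D² log H(v,v) + D² log H(Jv,Jv)`, the condition `ρ ≤ 0` says that `log H` is plurisubharmonic.

Claim 1: passing from `log H` to `F` only adds squares of first derivatives, so `F` is
plurisubharmonic too. For real `v`, the second derivative of the average of `F` along `v` is the
average of `D²F(v,v)`. The average of `D²F(Jv,Jv)` vanishes by periodicity, so adding it turns the
integrand into the nonnegative Levi form (`convexOn_integral_of_plurisubharmonic`).

Claim 2: invariance makes `H` a function of `x` alone. Then `log Vol_J(L_x)` is `½ log H(x)` plus a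
constant, and the Levi form of `log H` reduces to its real Hessian on `ℝⁿ`, evaluated at `Re v` and
at `Re Jv`. -/

/-! ### Convexity, lines and Hessians -/

/-- Convexity may be tested on affine lines. -/
theorem convexOn_univ_of_lines {E : Type*} [AddCommGroup E] [Module ℝ E] {f : E → ℝ}
    (hf : ∀ x v : E, ConvexOn ℝ univ (fun t : ℝ => f (x + t • v))) : ConvexOn ℝ univ f := by
  refine ⟨convex_univ, fun x _ y _ a b ha hb hab => ?_⟩
  have h := (hf x (y - x)).2 (mem_univ 0) (mem_univ 1) ha hb hab
  have e : x + (a • (0 : ℝ) + b • (1 : ℝ)) • (y - x) = a • x + b • y := by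
    rw [← eq_sub_iff_add_eq] at hab
    subst hab
    simp only [smul_eq_mul, mul_zero, mul_one, zero_add]
    module
  simpa only [e, zero_smul, add_zero, one_smul, add_sub_cancel] using h

/-- A convex function restricts to a convex function on every affine line. -/
theorem _root_.ConvexOn.comp_line {E : Type*} [AddCommGroup E] [Module ℝ E] {f : E → ℝ}
    (hf : ConvexOn ℝ univ f) (x v : E) : ConvexOn ℝ univ (fun t : ℝ => f (x + t • v)) := by
  have h := hf.comp_affineMap (AffineMap.lineMap x (x + v))
  simpa [Function.comp_def, AffineMap.lineMap_apply, add_comm] using h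

theorem convexOn_univ_of_hasDerivAt {f f' f'' : ℝ → ℝ} (hf : ∀ t, HasDerivAt f (f' t) t)
    (hf' : ∀ t, HasDerivAt f' (f'' t) t) (hf'' : ∀ t, 0 ≤ f'' t) : ConvexOn ℝ univ f := by
  have e : deriv f = f' := funext fun t => (hf t).deriv
  refine convexOn_univ_of_deriv2_nonneg (fun t => (hf t).differentiableAt) ?_ fun t => ?_
  · rw [e]
    exact fun t => (hf' t).differentiableAt
  · simpa [e, (hf' t).deriv] using hf'' t

/-- The derivative of a differentiable convex function is monotone, and a monotone function has
nonnegative derivative. -/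
theorem second_derivative_nonneg_of_convexOn {f f' : ℝ → ℝ} {c t : ℝ} (hc : ConvexOn ℝ univ f)
    (hf : ∀ t, HasDerivAt f (f' t) t) (hf' : HasDerivAt f' c t) : 0 ≤ c := by
  have e : deriv f = f' := funext fun t => (hf t).deriv
  have hm : Monotone f' := by
    rw [← monotoneOn_univ, ← e]
    exact hc.monotoneOn_deriv fun t _ => (hf t).differentiableAt
  rw [← hf'.deriv]
  exact hm.deriv_nonneg

section Lines

variable {E : Type*} [NormedAddCommGroup E] [NormedSpace ℝ E] {f : E → ℝ}

theorem hasDerivAt_line (x v : E) (t : ℝ) : HasDerivAt (fun t : ℝ => x + t • v) v t := by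
  simpa using ((hasDerivAt_id t).smul_const v).const_add x

theorem hasFDerivAt_fderiv_apply (hf : ContDiff ℝ ∞ f) (v z : E) :
    HasFDerivAt (fun z => fderiv ℝ f z v) ((fderiv ℝ (fderiv ℝ f) z).flip v) z := by
  have hg : Differentiable ℝ (fderiv ℝ f) :=
    (hf.fderiv_right (m := 1) (by norm_cast)).differentiable (by norm_num)
  simpa using (hg z).hasFDerivAt.clm_apply (hasFDerivAt_const v z)

theorem continuous_second_fderiv (hf : ContDiff ℝ ∞ f) :
    Continuous (fderiv ℝ (fderiv ℝ f)) :=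
  (hf.fderiv_right (m := 1) (by norm_cast)).continuous_fderiv (by norm_num)

theorem hasDerivAt_comp_line (hf : ContDiff ℝ ∞ f) (x v : E) (t : ℝ) :
    HasDerivAt (fun t : ℝ => f (x + t • v)) (fderiv ℝ f (x + t • v) v) t :=
  (hf.differentiable (by simp) _).hasFDerivAt.comp_hasDerivAt t (hasDerivAt_line x v t)

theorem hasDerivAt_fderiv_comp_line (hf : ContDiff ℝ ∞ f) (x v : E) (t : ℝ) :
    HasDerivAt (fun t : ℝ => fderiv ℝ f (x + t • v) v)
      (fderiv ℝ (fderiv ℝ f) (x + t • v) v v) t :=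
  (hasFDerivAt_fderiv_apply hf v _).comp_hasDerivAt t (hasDerivAt_line x v t)

/-- A smooth function is convex if and only if its Hessian is positive semi-definite. -/
theorem convexOn_univ_iff_second_fderiv_nonneg (hf : ContDiff ℝ ∞ f) :
    ConvexOn ℝ univ f ↔ ∀ x v, 0 ≤ fderiv ℝ (fderiv ℝ f) x v v := by
  constructor
  · intro h x v
    simpa using second_derivative_nonneg_of_convexOn (h.comp_line x v)
      (hasDerivAt_comp_line hf x v) (hasDerivAt_fderiv_comp_line hf x v 0)
  · exact fun h => convexOn_univ_of_lines fun x v => convexOn_univ_of_hasDerivAt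
      (hasDerivAt_comp_line hf x v) (hasDerivAt_fderiv_comp_line hf x v) fun t => h _ v

theorem concaveOn_univ_iff_second_fderiv_nonpos (hf : ContDiff ℝ ∞ f) :
    ConcaveOn ℝ univ f ↔ ∀ x v, fderiv ℝ (fderiv ℝ f) x v v ≤ 0 := by
  have e : fderiv ℝ (-f) = -fderiv ℝ f := funext fun x => fderiv_neg
  rw [← neg_convexOn_iff, convexOn_univ_iff_second_fderiv_nonneg (f := -f) hf.neg, e]
  refine forall₂_congr fun x v => ?_
  rw [fderiv_neg]
  simp

/-- The second derivative of `exp (f / 2)`. -/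
theorem second_fderiv_exp_half (hf : ContDiff ℝ ∞ f) (x v : E) :
    fderiv ℝ (fderiv ℝ fun z => Real.exp (f z / 2)) x v v
      = Real.exp (f x / 2) * (fderiv ℝ (fderiv ℝ f) x v v / 2 + (fderiv ℝ f x v / 2) ^ 2) := by
  have hF : ContDiff ℝ ∞ fun z => Real.exp (f z / 2) := (hf.div_const 2).exp
  -- The identity is needed for all `t`, so that it can be differentiated once more at `t = 0`;
  -- uniqueness of one-variable derivatives then gives the second derivative.
  have h1 : ∀ t : ℝ, fderiv ℝ (fun z => Real.exp (f z / 2)) (x + t • v) v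
      = Real.exp (f (x + t • v) / 2) * (fderiv ℝ f (x + t • v) v / 2) := fun t =>
    (hasDerivAt_comp_line hF x v t).unique ((hasDerivAt_comp_line hf x v t).div_const 2).exp
  have h2 := hasDerivAt_fderiv_comp_line hF x v 0
  simp only [h1] at h2
  have h3 := ((hasDerivAt_comp_line hf x v 0).div_const 2).exp.mul
    ((hasDerivAt_fderiv_comp_line hf x v 0).div_const 2)
  have h4 := h2.unique h3
  simp only [zero_smul, add_zero] at h4
  rw [h4]
  ring

/-- The second derivative of the pull-back of a function by a linear map. -/
theorem second_fderiv_comp_clm {G : Type*} [NormedAddCommGroup G] [NormedSpace ℝ G]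
    (hf : ContDiff ℝ ∞ f) (A : G →L[ℝ] E) (x v : G) :
    fderiv ℝ (fderiv ℝ fun z => f (A z)) x v v = fderiv ℝ (fderiv ℝ f) (A x) (A v) (A v) := by
  have hF : ContDiff ℝ ∞ fun z => f (A z) := hf.comp A.contDiff
  have h1 : ∀ t : ℝ, fderiv ℝ (fun z => f (A z)) (x + t • v) v
      = fderiv ℝ f (A x + t • A v) (A v) := fun t => by
    refine (hasDerivAt_comp_line hF x v t).unique ?_
    simpa using hasDerivAt_comp_line hf (A x) (A v) t
  have h2 := hasDerivAt_fderiv_comp_line hF x v 0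
  simp only [h1] at h2
  simpa using h2.unique (hasDerivAt_fderiv_comp_line hf (A x) (A v) 0)

end Lines

/-! ### Integration over a period cube -/

/-- Differentiation under the integral sign over a compact set. -/
theorem hasDerivAt_setIntegral_of_continuous {Y : Type*} [TopologicalSpace Y] [T2Space Y]
    [MeasurableSpace Y] [OpensMeasurableSpace Y] [SecondCountableTopology Y] {μ : Measure Y}
    [IsFiniteMeasureOnCompacts μ] {K : Set Y} (hK : IsCompact K) {G G' : ℝ → Y → ℝ}
    (hG : Continuous fun p : ℝ × Y => G p.1 p.2) (hG' : Continuous fun p : ℝ × Y => G' p.1 p.2)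
    (hd : ∀ t y, HasDerivAt (fun t => G t y) (G' t y) t) (t : ℝ) :
    HasDerivAt (fun t => ∫ y in K, G t y ∂μ) (∫ y in K, G' t y ∂μ) t := by
  have hGt : ∀ t, Continuous (G t) := fun t => hG.comp (by fun_prop : Continuous fun y => (t, y))
  have hG't : ∀ t, Continuous (G' t) := fun t =>
    hG'.comp (by fun_prop : Continuous fun y => (t, y))
  -- Continuity of `G'` on the compact set `[t - 1, t + 1] × K` yields a constant dominating
  -- function.
  obtain ⟨C, hC⟩ := ((isCompact_Icc (a := t - 1) (b := t + 1)).prod hK).exists_bound_of_continuousOn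
    hG'.continuousOn
  refine (hasDerivAt_integral_of_dominated_loc_of_deriv_le (bound := fun _ => C)
    (Icc_mem_nhds (by linarith) (by linarith) : Icc (t - 1) (t + 1) ∈ nhds t)
    (Filter.Eventually.of_forall fun s => (hGt s).aestronglyMeasurable)
    ((hGt t).continuousOn.integrableOn_compact hK) (hG't t).aestronglyMeasurable ?_ ?_ ?_).2
  · filter_upwards [ae_restrict_mem hK.measurableSet] with y hy s hs
    exact hC (s, y) ⟨hs, hy⟩
  · exact integrableOn_const hK.measure_lt_top.ne
  · exact Filter.Eventually.of_forall fun y s _ => hd s y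

/-- The integral of a directional derivative of a periodic function over a period cube is zero. -/
theorem setIntegral_fderiv_eq_zero_of_periodic {n : ℕ} {c : ℝ} (hc : 0 ≤ c)
    {g : (Fin n → ℝ) → ℝ} {g' : (Fin n → ℝ) → (Fin n → ℝ) →L[ℝ] ℝ}
    (hg : ∀ y, HasFDerivAt g (g' y) y) (hg' : Continuous g')
    (hper : ∀ y j, g (y + Pi.single j c) = g y) (v : Fin n → ℝ) :
    ∫ y in Icc (0 : Fin n → ℝ) (fun _ => c), g' y v = 0 := by
  cases n with
  | zero =>
    rw [Subsingleton.elim v 0]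
    simp only [map_zero, integral_zero]
  | succ n =>
    -- The directional derivative is the divergence of the field with components `v i • g`, so its
    -- integral is a sum of face differences.
    have hsum : ∀ y, g' y v = ∑ i, (v i • g' y) (Pi.single i 1) := fun y => by
      conv_lhs => rw [pi_eq_sum_univ' v]
      rw [map_sum]
      refine Finset.sum_congr rfl fun i _ => ?_
      rw [map_smul]
      rfl
    have hcont : Continuous g := continuous_iff_continuousAt.2 fun y => (hg y).continuousAt
    simp only [hsum]
    rw [integral_divergence_of_hasFDerivAt_off_countable' (0 : Fin (n + 1) → ℝ) (fun _ => c)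
      (fun _ => hc) (fun i y => v i • g y) (fun i y => v i • g' y) ∅ countable_empty
      (fun i => by fun_prop) (fun y _ i => (hg y).const_smul (v i))]
    · refine Finset.sum_eq_zero fun i _ => ?_
      rw [sub_eq_zero]
      refine integral_congr_ae (Filter.Eventually.of_forall fun y => ?_)
      -- Opposite faces differ by one period, so their contributions cancel.
      have e : i.insertNth c y = i.insertNth 0 y + (Pi.single i c : Fin (n + 1) → ℝ) := by
        ext j
        refine Fin.succAboveCases i ?_ (fun k => ?_) j <;> simp
      simp [e, hper]
    · refine Continuous.integrableOn_Icc ?_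
      fun_prop

/-! ### Real and imaginary directions; averages of plurisubharmonic functions -/

/-- The inclusion `ℝⁿ → ℂⁿ`. -/
def realInclusion (n : ℕ) : (Fin n → ℝ) →L[ℝ] Cn n :=
  ContinuousLinearMap.pi fun j =>
    Complex.ofRealCLM.comp (ContinuousLinearMap.proj (R := ℝ) j)

/-- The real part `ℂⁿ → ℝⁿ`. -/
def realPart (n : ℕ) : Cn n →L[ℝ] (Fin n → ℝ) :=
  ContinuousLinearMap.pi fun j =>
    Complex.reCLM.comp (ContinuousLinearMap.proj (R := ℝ) j)

theorem realPart_realInclusion {n : ℕ} (x : Fin n → ℝ) : realPart n (realInclusion n x) = x := by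
  ext j
  simp [realPart, realInclusion]

theorem realPart_J_realInclusion {n : ℕ} (x : Fin n → ℝ) :
    realPart n (J n (realInclusion n x)) = 0 := by
  ext j
  simp [realPart, realInclusion, J]

theorem J_realInclusion {n : ℕ} (x : Fin n → ℝ) : J n (realInclusion n x) = iMap n x := by
  ext j
  simp [realInclusion, J, iMap_apply]

theorem canonicalTorus_lift {n : ℕ} (x y : Fin n → ℝ) :
    (canonicalTorus x).lift y = realInclusion n x + iMap n y := by
  ext j
  simp [canonicalTorus, realInclusion, iMap_apply]

theorem proj_add_iMap_single {n : ℕ} (z : Cn n) (j : Fin n) :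
    proj (z + iMap n (Pi.single j (2 * Real.pi))) = proj z := by
  rw [proj, proj, eq_comm, QuotientAddGroup.eq]
  refine ⟨Pi.single j 1, fun k => ?_⟩
  rcases eq_or_ne k j with rfl | hk
  · simp [iMap_apply]
    ring
  · simp [iMap_apply, hk]

/-- The average of a plurisubharmonic function, periodic in the imaginary directions, over the
imaginary period cube is a convex function of the real parts. -/
theorem convexOn_integral_of_plurisubharmonic {n : ℕ} {F : Cn n → ℝ} (hF : ContDiff ℝ ∞ F) {c : ℝ}
    (hc : 0 ≤ c) (hper : ∀ z j, F (z + iMap n (Pi.single j c)) = F z)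
    (hpsh : ∀ z v, 0 ≤ fderiv ℝ (fderiv ℝ F) z v v + fderiv ℝ (fderiv ℝ F) z (J n v) (J n v)) :
    ConvexOn ℝ univ (fun x : Fin n → ℝ =>
      ∫ y in Icc (0 : Fin n → ℝ) (fun _ => c), F (realInclusion n x + iMap n y)) := by
  have hF1 : Continuous (fderiv ℝ F) := hF.continuous_fderiv (by simp)
  have hF2 := continuous_second_fderiv hF
  have hF0 := hF.continuous
  refine convexOn_univ_of_lines fun x v => ?_
  have hK : IsCompact (Icc (0 : Fin n → ℝ) (fun _ => c)) := isCompact_Icc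
  have hcomm : ∀ (t : ℝ) (y : Fin n → ℝ), realInclusion n (x + t • v) + iMap n y
      = (realInclusion n x + iMap n y) + t • realInclusion n v := fun t y => by
    rw [map_add, map_smul]
    abel
  simp only [hcomm]
  refine convexOn_univ_of_hasDerivAt
    (hasDerivAt_setIntegral_of_continuous hK
      (G' := fun t y => fderiv ℝ F (realInclusion n x + iMap n y + t • realInclusion n v)
        (realInclusion n v))
      (by fun_prop) (by fun_prop) fun t y => hasDerivAt_comp_line hF _ _ t)
    (hasDerivAt_setIntegral_of_continuous hK
      (G' := fun t y => fderiv ℝ (fderiv ℝ F)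
        (realInclusion n x + iMap n y + t • realInclusion n v)
        (realInclusion n v) (realInclusion n v))
      (by fun_prop) (by fun_prop) fun t y => hasDerivAt_fderiv_comp_line hF _ _ t) fun t => ?_
  simp only [← hcomm]
  set p := realInclusion n (x + t • v)
  have hper' : ∀ z j, fderiv ℝ F (z + iMap n (Pi.single j c)) = fderiv ℝ F z := fun z j => by
    rw [← fderiv_comp_add_right]
    simp only [hper]
  -- `J v` is tangent to the torus: the integrand is the `y`-derivative along `v` of the periodic
  -- function `y ↦ DF(p + iy)(Jv)`.
  have hzero : ∫ y in Icc (0 : Fin n → ℝ) (fun _ => c),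
      fderiv ℝ (fderiv ℝ F) (p + iMap n y) (iMap n v) (iMap n v) = 0 := by
    refine setIntegral_fderiv_eq_zero_of_periodic hc
      (g := fun y => fderiv ℝ F (p + iMap n y) (iMap n v))
      (g' := fun y => ((fderiv ℝ (fderiv ℝ F) (p + iMap n y)).flip (iMap n v)).comp (iMap n))
      (fun y => ?_) ?_ (fun y j => ?_) v
    · exact (hasFDerivAt_fderiv_apply hF (iMap n v) _).comp y ((iMap n).hasFDerivAt.const_add p)
    · have : Continuous fun y => (fderiv ℝ (fderiv ℝ F) (p + iMap n y)).flip :=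
        (ContinuousLinearMap.flipₗᵢ ℝ (Cn n) (Cn n) ℝ).continuous.comp (by fun_prop)
      fun_prop
    · rw [map_add, ← add_assoc, hper']
  have hadd := integral_add (μ := volume.restrict (Icc (0 : Fin n → ℝ) (fun _ => c)))
    (f := fun y => fderiv ℝ (fderiv ℝ F) (p + iMap n y) (realInclusion n v) (realInclusion n v))
    (g := fun y => fderiv ℝ (fderiv ℝ F) (p + iMap n y) (iMap n v) (iMap n v))
    (Continuous.integrableOn_Icc (by fun_prop)) (Continuous.integrableOn_Icc (by fun_prop))
  rw [hzero, add_zero] at hadd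
  rw [← hadd]
  refine integral_nonneg fun y => ?_
  have hy := hpsh (p + iMap n y) (realInclusion n v)
  rwa [J_realInclusion] at hy

/-! ### Curvature and the J-volume of canonical tori -/

namespace HermitianMetric

variable {n : ℕ} (h : HermitianMetric n)

/-- `ρ(v, Jv)` is minus half of the Levi form of `log H`. -/
theorem rho_apply_J (z v : Cn n) :
    h.rho z v (J n v) = -(fderiv ℝ (fderiv ℝ fun z => Real.log (h.H z)) z v v
      + fderiv ℝ (fderiv ℝ fun z => Real.log (h.H z)) z (J n v) (J n v)) / 2 := by
  have hJ : J n (J n v) = -v := by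
    ext j
    simp [J, ← mul_assoc]
  -- The mixed terms `D²(v, Jv)` and `D²(Jv, v)` become purely imaginary after multiplication by
  -- `i`; `J² = -1` turns the others into the Levi form.
  simp only [rho, chernCurvature, extD, chernForm, fderiv_del_apply h.contDiff_log_H, hJ, map_neg]
  simp
  ring

theorem exp_half_log_H (z : Cn n) : Real.exp (Real.log (h.H z) / 2) = Real.sqrt (h.H z) := by
  rw [Real.exp_half, Real.exp_log (h.H_pos z)]

/-- The determinant of a basis on itself is `1`, leaving the norm `|σ|_h = √H`. The exponential form
prepares for differentiating through `log H`. -/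
theorem volJDensity_canonicalTorus (x y : Fin n → ℝ) :
    h.volJDensity (canonicalTorus x) y
      = Real.exp (Real.log (h.H (realInclusion n x + iMap n y)) / 2) := by
  have ht : (canonicalTorus x).tangent y = partialY := by
    funext j
    change fderiv ℝ (fun y : Fin n → ℝ => fun j => (x j : ℂ) + Complex.I * y j) y _ = _
    rw [(hasFDerivAt_canonical x y).fderiv]
    ext k
    rcases eq_or_ne k j with rfl | hk
    · simp [iMap_apply, partialY]
    · simp [iMap_apply, partialY, hk]
  have hf : ⇑((canonicalTorus x).frame y) = (canonicalTorus x).tangent y := by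
    simp [TRTorus.frame]
  have hd : ((canonicalTorus x).frame y).det ((canonicalTorus x).tangent y) = 1 := by
    rw [← hf, Module.Basis.det_self]
  rw [exp_half_log_H, volJDensity, omegaJ, AlternatingMap.smul_apply, hd, hf, ht,
    canonicalTorus_lift]
  simp [norm, H]

theorem VolJ_canonicalTorus (x : Fin n → ℝ) :
    h.VolJ (canonicalTorus x) = ∫ y in Icc (0 : Fin n → ℝ) (fun _ => 2 * Real.pi),
      Real.exp (Real.log (h.H (realInclusion n x + iMap n y)) / 2) := by
  simp only [VolJ, volJDensity_canonicalTorus]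

theorem convexOn_VolJ_of_curvatureNonpos (hρ : h.CurvatureNonpos) :
    ConvexOn ℝ univ (fun x : Fin n → ℝ => h.VolJ (canonicalTorus x)) := by
  simp only [VolJ_canonicalTorus]
  refine convexOn_integral_of_plurisubharmonic (F := fun z => Real.exp (Real.log (h.H z) / 2))
    (h.contDiff_log_H.div_const 2).exp (by positivity) (fun z j => ?_) fun z v => ?_
  · simp only [H, proj_add_iMap_single]
  · have := hρ z v
    rw [rho_apply_J] at this
    -- The Levi form of `exp(½ log H)` is a positive multiple of half that of `log H` plus two
    -- squares.
    rw [second_fderiv_exp_half h.contDiff_log_H, second_fderiv_exp_half h.contDiff_log_H, ← mul_add]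
    refine mul_nonneg (Real.exp_pos _).le ?_
    linarith [sq_nonneg (fderiv ℝ (fun z => Real.log (h.H z)) z v / 2),
      sq_nonneg (fderiv ℝ (fun z => Real.log (h.H z)) z (J n v) / 2)]

/-! ### Torus-invariant metrics -/

variable {h}

theorem IsTorusInvariant.H_eq (hinv : h.IsTorusInvariant) (x y : Fin n → ℝ) :
    h.H (realInclusion n x + iMap n y) = h.H (realInclusion n x) := by
  have e : proj (realInclusion n x + iMap n y) = rotate y (proj (realInclusion n x)) := by
    rw [rotate]
    change _ = proj (realInclusion n x + _)
    congr 2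
  rw [H, H, e, hinv]

theorem IsTorusInvariant.log_H_eq (hinv : h.IsTorusInvariant) :
    (fun z => Real.log (h.H z))
      = fun z => (fun x => Real.log (h.H (realInclusion n x))) (realPart n z) := by
  funext z
  have e : z = realInclusion n (realPart n z) + iMap n (fun j => (z j).im) := by
    ext j
    simp [realInclusion, realPart, iMap_apply, mul_comm Complex.I]
  conv_lhs => rw [e, hinv.H_eq]

theorem contDiff_log_H_real (h : HermitianMetric n) :
    ContDiff ℝ ∞ fun x => Real.log (h.H (realInclusion n x)) :=
  h.contDiff_log_H.comp (realInclusion n).contDiff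

/-- For an invariant metric `log Vol_J` is, up to a constant, half of `log H`. -/
theorem IsTorusInvariant.log_VolJ (hinv : h.IsTorusInvariant) (x : Fin n → ℝ) :
    Real.log (h.VolJ (canonicalTorus x))
      = (1 / 2 : ℝ) * Real.log (h.H (realInclusion n x)) + n * Real.log (2 * Real.pi) := by
  have hpi := Real.two_pi_pos
  rw [VolJ_canonicalTorus]
  simp only [hinv.H_eq]
  have hvol := Real.volume_Icc_pi_toReal (a := (0 : Fin n → ℝ)) (b := fun _ => 2 * Real.pi)
    fun _ => hpi.le
  rw [setIntegral_const, Measure.real, hvol, smul_eq_mul,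
    Real.log_mul (by simp [Real.pi_ne_zero]) (Real.exp_pos _).ne', Real.log_exp]
  simp
  ring

theorem IsTorusInvariant.rho_apply_J (hinv : h.IsTorusInvariant) (z v : Cn n) :
    h.rho z v (J n v) = -(fderiv ℝ (fderiv ℝ fun x => Real.log (h.H (realInclusion n x)))
        (realPart n z) (realPart n v) (realPart n v)
      + fderiv ℝ (fderiv ℝ fun x => Real.log (h.H (realInclusion n x)))
        (realPart n z) (realPart n (J n v)) (realPart n (J n v))) / 2 := by
  rw [h.rho_apply_J, hinv.log_H_eq, second_fderiv_comp_clm h.contDiff_log_H_real,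
    second_fderiv_comp_clm h.contDiff_log_H_real]

/-- A real vector `v` has `Re Jv = 0`, so testing on it isolates a single Hessian term; conversely,
for any `v` the two terms are values of the same real Hessian. -/
theorem IsTorusInvariant.curvatureNonpos_iff (hinv : h.IsTorusInvariant) :
    h.CurvatureNonpos ↔ ConvexOn ℝ univ fun x => Real.log (h.H (realInclusion n x)) := by
  rw [convexOn_univ_iff_second_fderiv_nonneg h.contDiff_log_H_real]
  constructor
  · intro hρ x v
    have := hρ (realInclusion n x) (realInclusion n v)
    rw [hinv.rho_apply_J, realPart_realInclusion, realPart_realInclusion,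
      realPart_J_realInclusion] at this
    simp only [map_zero, add_zero] at this
    linarith
  · intro hc z v
    rw [hinv.rho_apply_J]
    linarith [hc (realPart n z) (realPart n v), hc (realPart n z) (realPart n (J n v))]

theorem IsTorusInvariant.curvatureNonneg_iff (hinv : h.IsTorusInvariant) :
    h.CurvatureNonneg ↔ ConcaveOn ℝ univ fun x => Real.log (h.H (realInclusion n x)) := by
  rw [concaveOn_univ_iff_second_fderiv_nonpos h.contDiff_log_H_real]
  constructor
  · intro hρ x v
    have := hρ (realInclusion n x) (realInclusion n v)
    rw [hinv.rho_apply_J, realPart_realInclusion, realPart_realInclusion,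
      realPart_J_realInclusion] at this
    simp only [map_zero, add_zero] at this
    linarith
  · intro hc z v
    rw [hinv.rho_apply_J]
    linarith [hc (realPart n z) (realPart n v), hc (realPart n z) (realPart n (J n v))]

end HermitianMetric

theorem convexOn_mul_add_const_iff {E : Type*} [AddCommGroup E] [Module ℝ E] {f : E → ℝ}
    {a : ℝ} (ha : 0 < a) (b : ℝ) :
    ConvexOn ℝ univ (fun x => a * f x + b) ↔ ConvexOn ℝ univ f := by
  refine ⟨fun hf => ?_, fun hf => (hf.smul ha.le).add_const b⟩
  -- The inverse affine change: subtract `b`, then scale by `a⁻¹ > 0`.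
  have := (hf.add_const (-b)).smul (inv_pos.2 ha).le
  simpa [ha.ne'] using this

theorem concaveOn_mul_add_const_iff {E : Type*} [AddCommGroup E] [Module ℝ E] {f : E → ℝ}
    {a : ℝ} (ha : 0 < a) (b : ℝ) :
    ConcaveOn ℝ univ (fun x => a * f x + b) ↔ ConcaveOn ℝ univ f := by
  refine ⟨fun hf => ?_, fun hf => (hf.smul ha.le).add_const b⟩
  have := (hf.add_const (-b)).smul (inv_pos.2 ha).le
  simpa [ha.ne'] using this

end TorusVolume

end

theorem mainTheorem3 (n : ℕ) (h : TorusVolume.HermitianMetric n) :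
    (h.CurvatureNonpos →
      ConvexOn ℝ Set.univ (fun x : Fin n → ℝ => h.VolJ (TorusVolume.canonicalTorus x))) ∧
    (h.IsTorusInvariant →
      (h.CurvatureNonpos ↔
        ConvexOn ℝ Set.univ
          (fun x : Fin n → ℝ => Real.log (h.VolJ (TorusVolume.canonicalTorus x)))) ∧
      (h.CurvatureNonneg ↔
        ConcaveOn ℝ Set.univ
          (fun x : Fin n → ℝ => Real.log (h.VolJ (TorusVolume.canonicalTorus x))))) := by
  refine ⟨h.convexOn_VolJ_of_curvatureNonpos, fun hinv => ?_⟩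
  simp only [hinv.log_VolJ]
  rw [TorusVolume.convexOn_mul_add_const_iff one_half_pos,
    TorusVolume.concaveOn_mul_add_const_iff one_half_pos]
  exact ⟨hinv.curvatureNonpos_iff, hinv.curvatureNonneg_iff⟩
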